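/- For $m\times m$ real symmetric matrices $A,B$ with $p(x)=\det(xI-A)$ and $q(x)=\det(xI-B)$, write \[ [p\boxplus_m q](x)=\mathbb{E}_Q\det(xI-A-QBQ^T),\qquad [p\boxtimes_m q](x)=\mathbb{E}_Q\det(xI-AQBQ^T), \] where $Q$ is a random $m\times m$ real orthogonal matrix distributed according to normalised Haar measure (both expressions depend only on $p$ and $q$). Two $m\times m$ real symmetric matrices $A$ and $B$ are in finite free position if \[ \det(xI-yA-zB)=\det(xI-yA)\boxplus_m\det(xI-zB)\qquad\text{for all } y,z\in\mathbb{R}, \] identically in $x$. Corollary. Let $A$ and $B$ be $m\times m$ real symmetric matrices in finite free position with $A^2=A$. Then \[ \det(xI-AB)=\det(xI-A)\boxtimes_m\det(xI-B). \] Moreover, the same holds with $\boxtimes_m$ given by its coefficient formula: if $\det(xI-A)=\sum_{i=0}^m x^{m-i}(-1)^ip_i$ and $\det(xI-B)=\sum_{i=0}^m x^{m-i}(-1)^iq_i$, then \[ \det(xI-AB)=\sum_{i=0}^m x^{m-i}(-1)^i\,\frac{p_iq_i}{\binom{m}{i}} . \] -/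

import Mathlib

open MeasureTheory Polynomial

namespace FiniteFree

instance orthogonalMeasurableSpace (m : ℕ) :
    MeasurableSpace (Matrix.orthogonalGroup (Fin m) ℝ) := borel _

instance orthogonalBorelSpace (m : ℕ) :
    BorelSpace (Matrix.orthogonalGroup (Fin m) ℝ) := ⟨rfl⟩

instance orthogonalCompactSpace (m : ℕ) :
    CompactSpace (Matrix.orthogonalGroup (Fin m) ℝ) := by
  refine isCompact_iff_compactSpace.mp ?_
  have hK : IsCompact (Set.univ.pi fun _ => Set.univ.pi fun _ => Set.Icc (-1) 1 :
      Set (Fin m → Fin m → ℝ)) :=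
    isCompact_univ_pi fun _ => isCompact_univ_pi fun _ => isCompact_Icc
  refine IsCompact.of_isClosed_subset (s := (Set.univ.pi fun _ => Set.univ.pi fun _ =>
      Set.Icc (-1) 1 : Set (Matrix (Fin m) (Fin m) ℝ))) hK ?_ ?_
  · have hc : IsClosed {Q : Matrix (Fin m) (Fin m) ℝ | star Q * Q = 1 ∧ Q * star Q = 1} :=
      (isClosed_eq (by fun_prop) continuous_const).inter
        (isClosed_eq (by fun_prop) continuous_const)
    exact hc
  · intro Q hQ i _ j _
    have h := entry_norm_bound_of_unitary (𝕜 := ℝ) hQ i j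
    exact abs_le.mp (by simpa [Real.norm_eq_abs] using h)

/-- The uniform distribution on the group of `m × m` real orthogonal matrices: Haar measure
normalised to have total mass one. -/
noncomputable def uniform (m : ℕ) : Measure (Matrix.orthogonalGroup (Fin m) ℝ) :=
  Measure.haarMeasure ⊤

/-- `E_Q det(xI - A - Q B Qᵀ)` with `Q` uniform on the orthogonal group. -/
noncomputable def addExpect {m : ℕ} (A B : Matrix (Fin m) (Fin m) ℝ) (x : ℝ) : ℝ :=
  ∫ Q : Matrix.orthogonalGroup (Fin m) ℝ,
    (x • (1 : Matrix (Fin m) (Fin m) ℝ) - A - Q.1 * B * Q.1.transpose).det ∂uniform m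

/-- `E_Q det(xI - A Q B Qᵀ)` with `Q` uniform on the orthogonal group. -/
noncomputable def mulExpect {m : ℕ} (A B : Matrix (Fin m) (Fin m) ℝ) (x : ℝ) : ℝ :=
  ∫ Q : Matrix.orthogonalGroup (Fin m) ℝ,
    (x • (1 : Matrix (Fin m) (Fin m) ℝ) - A * (Q.1 * B * Q.1.transpose)).det ∂uniform m

/-- `p` is the characteristic polynomial of an `m × m` real symmetric matrix. -/
def IsSymmCharpoly (m : ℕ) (p : ℝ[X]) : Prop :=
  ∃ A : Matrix (Fin m) (Fin m) ℝ, A.IsSymm ∧ A.charpoly = p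

open Classical in
/-- The symmetric additive convolution `[p ⊞ₘ q](x) = E_Q det(xI - A - Q B Qᵀ)`, where `A`, `B`
are real symmetric with `p(x) = det(xI - A)` and `q(x) = det(xI - B)`. The choice of `A` and `B`
does not matter, see `addConv_charpoly`. -/
noncomputable def addConv (m : ℕ) (p q : ℝ[X]) (x : ℝ) : ℝ :=
  if h : IsSymmCharpoly m p ∧ IsSymmCharpoly m q then
    addExpect h.1.choose h.2.choose x
  else 0

open Classical in
/-- The symmetric multiplicative convolution `[p ⊠ₘ q](x) = E_Q det(xI - A Q B Qᵀ)`, where `A`, `B`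
are real symmetric with `p(x) = det(xI - A)` and `q(x) = det(xI - B)`. The choice of `A` and `B`
does not matter, see `mulConv_charpoly`. -/
noncomputable def mulConv (m : ℕ) (p q : ℝ[X]) (x : ℝ) : ℝ :=
  if h : IsSymmCharpoly m p ∧ IsSymmCharpoly m q then
    mulExpect h.1.choose h.2.choose x
  else 0

/-- The number `pᵢ` in `p(x) = ∑ᵢ x^(m-i) (-1)^i pᵢ`. -/
def signedCoeff (m : ℕ) (p : ℝ[X]) (i : ℕ) : ℝ := (-1) ^ i * p.coeff (m - i)

/-- The multiplicative convolution given by its linear formula on coefficients,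
`∑ᵢ x^(m-i) (-1)^i pᵢ qᵢ / binom(m,i)`. -/
noncomputable def mulConvCoeff (m : ℕ) (p q : ℝ[X]) (x : ℝ) : ℝ :=
  ∑ i ∈ Finset.range (m + 1),
    x ^ (m - i) * (-1) ^ i * (signedCoeff m p i * signedCoeff m q i / (m.choose i : ℝ))

/-- Two real symmetric `m × m` matrices are in finite free position if
`det(xI - yA - zB) = det(xI - yA) ⊞ₘ det(xI - zB)` for all real `y`, `z` (identically in `x`). -/
def InFiniteFreePosition {m : ℕ} (A B : Matrix (Fin m) (Fin m) ℝ) : Prop :=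
  ∀ y z x : ℝ, (x • (1 : Matrix (Fin m) (Fin m) ℝ) - y • A - z • B).det =
    addConv m (y • A).charpoly (z • B).charpoly x

/-! The convolutions are well defined: the expectations depend only on the characteristic
polynomials. -/

instance uniform_isHaar (m : ℕ) : (uniform m).IsHaarMeasure := by
  unfold uniform; infer_instance

instance uniform_isProbability (m : ℕ) : IsProbabilityMeasure (uniform m) := by
  constructor
  have h := Measure.haarMeasure_self
    (K₀ := (⊤ : TopologicalSpace.PositiveCompacts (Matrix.orthogonalGroup (Fin m) ℝ)))
  simpa [uniform] using h

instance uniform_isMulRightInvariant (m : ℕ) : (uniform m).IsMulRightInvariant := by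
  constructor
  intro g
  have h1 : IsProbabilityMeasure ((uniform m).map (· * g)) :=
    Measure.isProbabilityMeasure_map (measurable_mul_const g).aemeasurable
  have h2 : ((uniform m).map (· * g)).IsHaarMeasure := inferInstance
  exact Measure.isHaarMeasure_eq_of_isProbabilityMeasure _ _

theorem exists_conj {m : ℕ} {A A' : Matrix (Fin m) (Fin m) ℝ} (hA : A.IsSymm) (hA' : A'.IsSymm)
    (h : A'.charpoly = A.charpoly) :
    ∃ P : Matrix.orthogonalGroup (Fin m) ℝ, A' = P.1 * A * P.1.transpose := by
  have hH : A.IsHermitian := by simpa [Matrix.IsHermitian, Matrix.IsSymm] using hA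
  have hH' : A'.IsHermitian := by simpa [Matrix.IsHermitian, Matrix.IsSymm] using hA'
  have he : hH'.eigenvalues = hH.eigenvalues :=
    (Matrix.IsHermitian.eigenvalues_eq_eigenvalues_iff hH' hH).2 h
  have s := hH.conjStarAlgAut_star_eigenvectorUnitary
  have s' := hH'.spectral_theorem
  rw [he, ← s, Unitary.conjStarAlgAut_apply, Unitary.conjStarAlgAut_apply] at s'
  refine ⟨hH'.eigenvectorUnitary * star hH.eigenvectorUnitary, ?_⟩
  refine s'.trans ?_
  simp [Matrix.star_eq_conjTranspose, Matrix.transpose_mul, Matrix.mul_assoc]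

theorem integral_conj {m : ℕ} (P R : Matrix.orthogonalGroup (Fin m) ℝ)
    (f : Matrix.orthogonalGroup (Fin m) ℝ → ℝ) :
    ∫ Q, f (P * Q * R⁻¹) ∂uniform m = ∫ Q, f Q ∂uniform m := by
  rw [integral_mul_left_eq_self (fun Q => f (Q * R⁻¹)) P, integral_mul_right_eq_self f R⁻¹]

theorem transpose_mul_self {m : ℕ} (P : Matrix.orthogonalGroup (Fin m) ℝ) :
    P.1.transpose * P.1 = 1 := by
  simpa [Matrix.star_eq_conjTranspose] using P.2.1

theorem inv_val {m : ℕ} (P : Matrix.orthogonalGroup (Fin m) ℝ) :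
    (P⁻¹).1 = P.1.transpose := by
  change star P.1 = _
  simp [Matrix.star_eq_conjTranspose]

theorem det_conj {m : ℕ} (P : Matrix.orthogonalGroup (Fin m) ℝ) (M : Matrix (Fin m) (Fin m) ℝ) :
    (P.1.transpose * M * P.1).det = M.det := by
  rw [Matrix.det_mul_right_comm, transpose_mul_self, one_mul]

theorem transpose_mul_cancel {m : ℕ} (P : Matrix.orthogonalGroup (Fin m) ℝ)
    (M : Matrix (Fin m) (Fin m) ℝ) : P.1.transpose * (P.1 * M) = M := by
  rw [← Matrix.mul_assoc, transpose_mul_self, Matrix.one_mul]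

theorem addExpect_conj {m : ℕ} (A B : Matrix (Fin m) (Fin m) ℝ)
    (P R : Matrix.orthogonalGroup (Fin m) ℝ) (x : ℝ) :
    addExpect (P.1 * A * P.1.transpose) (R.1 * B * R.1.transpose) x = addExpect A B x := by
  unfold addExpect
  rw [← integral_conj P R]
  congr 1
  funext Q
  rw [← det_conj P]
  congr 1
  simp only [Submonoid.coe_mul, inv_val, Matrix.transpose_mul, Matrix.transpose_transpose,
    Matrix.mul_sub, Matrix.sub_mul, Matrix.mul_assoc, Matrix.mul_smul, Matrix.smul_mul,
    transpose_mul_self, transpose_mul_cancel, Matrix.mul_one]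

theorem mulExpect_conj {m : ℕ} (A B : Matrix (Fin m) (Fin m) ℝ)
    (P R : Matrix.orthogonalGroup (Fin m) ℝ) (x : ℝ) :
    mulExpect (P.1 * A * P.1.transpose) (R.1 * B * R.1.transpose) x = mulExpect A B x := by
  unfold mulExpect
  rw [← integral_conj P R]
  congr 1
  funext Q
  rw [← det_conj P]
  congr 1
  simp only [Submonoid.coe_mul, inv_val, Matrix.transpose_mul, Matrix.transpose_transpose,
    Matrix.mul_sub, Matrix.sub_mul, Matrix.mul_assoc, Matrix.mul_smul, Matrix.smul_mul,
    transpose_mul_self, transpose_mul_cancel, Matrix.mul_one]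

theorem addConv_charpoly {m : ℕ} {A B : Matrix (Fin m) (Fin m) ℝ} (hA : A.IsSymm) (hB : B.IsSymm)
    (x : ℝ) : addConv m A.charpoly B.charpoly x = addExpect A B x := by
  have h : IsSymmCharpoly m A.charpoly ∧ IsSymmCharpoly m B.charpoly :=
    ⟨⟨A, hA, rfl⟩, ⟨B, hB, rfl⟩⟩
  obtain ⟨P, hP⟩ := exists_conj hA h.1.choose_spec.1 h.1.choose_spec.2
  obtain ⟨R, hR⟩ := exists_conj hB h.2.choose_spec.1 h.2.choose_spec.2
  rw [addConv, dif_pos h, hP, hR, addExpect_conj]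

theorem mulConv_charpoly {m : ℕ} {A B : Matrix (Fin m) (Fin m) ℝ} (hA : A.IsSymm) (hB : B.IsSymm)
    (x : ℝ) : mulConv m A.charpoly B.charpoly x = mulExpect A B x := by
  have h : IsSymmCharpoly m A.charpoly ∧ IsSymmCharpoly m B.charpoly :=
    ⟨⟨A, hA, rfl⟩, ⟨B, hB, rfl⟩⟩
  obtain ⟨P, hP⟩ := exists_conj hA h.1.choose_spec.1 h.1.choose_spec.2
  obtain ⟨R, hR⟩ := exists_conj hB h.2.choose_spec.1 h.2.choose_spec.2
  rw [mulConv, dif_pos h, hP, hR, mulExpect_conj]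

end FiniteFree

namespace FiniteFree

open Finset

variable {m : ℕ}

/-! Finite free position concerns sums, so the product `A * M` must be reached from the pencils `y •
A + M`. For a projection `A`, multiplying `t⁻¹ - (t⁻¹ - x) • A - M` by `t • (1 - A) + A` cancels
every pole in `t`; the determinant of the result is `pencilDet`. For `t ≠ 0`, finite free position
says that its value at `M = B` is its average over `M = Q B Qᵀ`. Both sides are continuous in `t`,
so this persists at `t = 0`, where a factor independent of `M` turns it into `det (x - A * M)`.

The coefficient formula holds for every symmetric `A`. After diagonalising, expansion by rows and
invariance of Haar measure under permutation matrices give a combination of elementary symmetric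
functions of the eigenvalues; scalar `A` determines its coefficients. -/

theorem integrable_of_continuous {f : Matrix.orthogonalGroup (Fin m) ℝ → ℝ} (hf : Continuous f) :
    Integrable f (uniform m) :=
  hf.integrable_of_hasCompactSupport (HasCompactSupport.of_compactSpace f)

theorem continuous_val :
    Continuous (fun Q : Matrix.orthogonalGroup (Fin m) ℝ => Q.1) := continuous_subtype_val

/-! ### The multiplicative convolution in terms of coefficients -/

/-- The matrix whose rows with index in `S` are those of `-N` and whose other rows are those of
`x • 1`. -/
def mixedRows (x : ℝ) (N : Matrix (Fin m) (Fin m) ℝ) (S : Finset (Fin m)) :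
    Matrix (Fin m) (Fin m) ℝ :=
  Matrix.of fun i j => if i ∈ S then -N i j else (x • (1 : Matrix (Fin m) (Fin m) ℝ)) i j

theorem continuous_mixedRows (x : ℝ) (S : Finset (Fin m)) :
    Continuous fun N : Matrix (Fin m) (Fin m) ℝ => mixedRows x N S := by
  refine continuous_matrix fun i j => ?_
  simp only [mixedRows, Matrix.of_apply]
  split_ifs <;> fun_prop

/-- The determinant is multilinear in the rows: `S` records the rows where the summand containing
`N` is chosen, each contributing its factor `a i`. -/
theorem det_sub_diagonal_mul (x : ℝ) (a : Fin m → ℝ) (N : Matrix (Fin m) (Fin m) ℝ) :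
    (x • (1 : Matrix (Fin m) (Fin m) ℝ) - Matrix.diagonal a * N).det =
      ∑ S : Finset (Fin m), (∏ i ∈ S, a i) * (mixedRows x N S).det := by
  have h1 : x • (1 : Matrix (Fin m) (Fin m) ℝ) - Matrix.diagonal a * N =
      (Matrix.of fun i j => a i * -N i j) + (x • (1 : Matrix (Fin m) (Fin m) ℝ)) := by
    ext i j
    simp [Matrix.diagonal_mul]
    ring
  rw [h1]
  refine ((Matrix.detRowAlternating (R := ℝ) (n := Fin m)).toMultilinearMap.map_add_univ _ _).trans
    (Finset.sum_congr rfl fun S _ => ?_)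
  have h2 := (Matrix.detRowAlternating (R := ℝ) (n := Fin m)).toMultilinearMap.map_piecewise_smul
    a (mixedRows x N S) S
  rw [smul_eq_mul] at h2
  refine Eq.trans ?_ h2
  congr 1
  funext i
  by_cases hi : i ∈ S
  · refine (if_pos hi).trans (Eq.trans ?_ (if_pos hi).symm)
    funext j
    simp [hi, mixedRows]
  · refine (if_neg hi).trans (Eq.trans ?_ (if_neg hi).symm)
    funext j
    simp [hi, mixedRows]

/-- The expected value of `det` of `mixedRows` over random orthogonal conjugates of `B`. -/
noncomputable def mixedExpect (x : ℝ) (B : Matrix (Fin m) (Fin m) ℝ) (S : Finset (Fin m)) : ℝ :=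
  ∫ Q : Matrix.orthogonalGroup (Fin m) ℝ,
    (mixedRows x (Q.1 * B * Q.1.transpose) S).det ∂uniform m

theorem continuous_conj (B : Matrix (Fin m) (Fin m) ℝ) :
    Continuous fun Q : Matrix.orthogonalGroup (Fin m) ℝ => Q.1 * B * Q.1.transpose :=
  (continuous_val.matrix_mul continuous_const).matrix_mul continuous_val.matrix_transpose

theorem mulExpect_diagonal (x : ℝ) (a : Fin m → ℝ) (B : Matrix (Fin m) (Fin m) ℝ) :
    mulExpect (Matrix.diagonal a) B x =
      ∑ S : Finset (Fin m), (∏ i ∈ S, a i) * mixedExpect x B S := by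
  unfold mulExpect mixedExpect
  simp_rw [det_sub_diagonal_mul]
  rw [integral_finsetSum]
  · simp_rw [integral_const_mul]
  · intro S _
    exact (integrable_of_continuous
      ((continuous_mixedRows x S).comp (continuous_conj B)).matrix_det).const_mul _

theorem submatrix_one_mem_orthogonalGroup (σ : Equiv.Perm (Fin m)) :
    (1 : Matrix (Fin m) (Fin m) ℝ).submatrix σ id ∈ Matrix.orthogonalGroup (Fin m) ℝ := by
  rw [Matrix.mem_orthogonalGroup_iff, Matrix.transpose_submatrix,
    ← Matrix.submatrix_mul _ _ _ _ _ Function.bijective_id]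
  simp

theorem mixedExpect_map (x : ℝ) (B : Matrix (Fin m) (Fin m) ℝ) (σ : Equiv.Perm (Fin m))
    (S T : Finset (Fin m)) (h : ∀ i, σ i ∈ T ↔ i ∈ S) :
    mixedExpect x B S = mixedExpect x B T := by
  let P : Matrix.orthogonalGroup (Fin m) ℝ := ⟨_, submatrix_one_mem_orthogonalGroup σ⟩
  unfold mixedExpect
  -- Left translation by a permutation matrix permutes the rows and columns of `Q B Qᵀ`
  -- simultaneously, which carries the rows in `T` to those in `S`.
  rw [← integral_mul_left_eq_self _ P]
  congr 1
  funext Q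
  rw [← Matrix.det_submatrix_equiv_self σ (mixedRows x (Q.1 * B * Q.1.transpose) T)]
  have hP : (P * Q).1 = Q.1.submatrix σ id := by
    change (1 : Matrix (Fin m) (Fin m) ℝ).submatrix σ id * Q.1 = _
    ext i j
    simp [Matrix.mul_apply, Matrix.one_apply]
  have hN : (P * Q).1 * B * (P * Q).1.transpose =
      (Q.1 * B * Q.1.transpose).submatrix σ σ := by
    rw [hP]
    ext i j
    simp [Matrix.mul_apply]
  rw [hN]
  congr 1
  ext i j
  simp [mixedRows, h, Matrix.one_apply]

theorem mixedExpect_eq_of_card_eq (x : ℝ) (B : Matrix (Fin m) (Fin m) ℝ) {S T : Finset (Fin m)}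
    (h : #S = #T) : mixedExpect x B S = mixedExpect x B T := by
  let e : {i // i ∈ S} ≃ {i // i ∈ T} := Finset.equivOfCardEq h
  refine mixedExpect_map x B e.extendSubtype S T fun i => ⟨fun hi => ?_, fun hi => ?_⟩
  · by_contra hn
    exact e.extendSubtype_not_mem i hn hi
  · exact e.extendSubtype_mem i hi

theorem exists_mulExpect_diagonal_eq (x : ℝ) (B : Matrix (Fin m) (Fin m) ℝ) :
    ∃ d : ℕ → ℝ, ∀ a : Fin m → ℝ, mulExpect (Matrix.diagonal a) B x =
      ∑ k ∈ range (m + 1), d k * ∑ S ∈ powersetCard k univ, ∏ i ∈ S, a i := by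
  -- Only the size of `S` matters, so the first `k` indices serve as representative.
  refine ⟨fun k => mixedExpect x B (univ.filter fun i : Fin m => i.1 < k), fun a => ?_⟩
  rw [mulExpect_diagonal, ← Finset.powerset_univ, Finset.sum_powerset, Finset.card_univ,
    Fintype.card_fin]
  refine Finset.sum_congr rfl fun k hk => ?_
  rw [Finset.mul_sum]
  refine Finset.sum_congr rfl fun S hS => ?_
  rw [mul_comm]
  congr 1
  apply mixedExpect_eq_of_card_eq
  rw [(Finset.mem_powersetCard.1 hS).2, Fin.card_filter_val_lt]
  have := Finset.mem_range.1 hk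
  omega

theorem det_sub_smul_eq_sum (x : ℝ) (B : Matrix (Fin m) (Fin m) ℝ) {s : ℝ} (hs : s ≠ 0) :
    (x • (1 : Matrix (Fin m) (Fin m) ℝ) - s • B).det =
      ∑ k ∈ range (m + 1), x ^ (m - k) * (-1) ^ k * signedCoeff m B.charpoly k * s ^ k := by
  have h1 : x • (1 : Matrix (Fin m) (Fin m) ℝ) - s • B =
      s • (Matrix.scalar (Fin m) (x / s) - B) := by
    rw [smul_sub, Matrix.scalar_apply, ← Matrix.smul_one_eq_diagonal, smul_smul,
      mul_div_cancel₀ _ hs]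
  rw [h1, Matrix.det_smul, ← Matrix.eval_charpoly, Polynomial.eval_eq_sum_range,
    Matrix.charpoly_natDegree_eq_dim, Fintype.card_fin, Finset.mul_sum,
    ← Finset.sum_range_reflect]
  refine Finset.sum_congr rfl fun k hk => ?_
  have hk' : k ≤ m := Nat.lt_succ_iff.1 (Finset.mem_range.1 hk)
  have h2 : m + 1 - 1 - k = m - k := by omega
  have h3 : s ^ m = s ^ k * s ^ (m - k) := by rw [← pow_add]; congr 1; omega
  have h4 : ((-1 : ℝ) ^ k) * (-1) ^ k = 1 := by rw [← mul_pow]; simp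
  rw [h2, h3, div_pow, signedCoeff]
  have h5 : s ^ (m - k) ≠ 0 := pow_ne_zero _ hs
  field_simp
  linear_combination (-(x ^ (m - k) * B.charpoly.coeff (m - k))) * h4

theorem mulExpect_smul_one (x s : ℝ) (B : Matrix (Fin m) (Fin m) ℝ) :
    mulExpect (Matrix.diagonal fun _ => s) B x =
      (x • (1 : Matrix (Fin m) (Fin m) ℝ) - s • B).det := by
  unfold mulExpect
  have h : ∀ Q : Matrix.orthogonalGroup (Fin m) ℝ,
      (x • (1 : Matrix (Fin m) (Fin m) ℝ) -
        Matrix.diagonal (fun _ => s) * (Q.1 * B * Q.1.transpose)).det =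
      (x • (1 : Matrix (Fin m) (Fin m) ℝ) - s • B).det := by
    intro Q
    rw [← det_conj Q]
    congr 1
    simp only [← Matrix.smul_one_eq_diagonal, Matrix.mul_sub, Matrix.sub_mul, Matrix.mul_assoc,
      Matrix.mul_smul, Matrix.smul_mul, transpose_mul_self, transpose_mul_cancel, Matrix.mul_one,
      Matrix.one_mul]
  simp_rw [h]
  simp

/-- The coefficients `d k` do not depend on `a`, so they can be read off from constant `a = s`,
where the `k`-th elementary symmetric function is `m.choose k * s ^ k` and no averaging is left. -/
theorem mulExpect_diagonal_eq (x : ℝ) (B : Matrix (Fin m) (Fin m) ℝ) (a : Fin m → ℝ) :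
    mulExpect (Matrix.diagonal a) B x =
      ∑ k ∈ range (m + 1), x ^ (m - k) * (-1) ^ k *
        ((∑ S ∈ powersetCard k univ, ∏ i ∈ S, a i) * signedCoeff m B.charpoly k /
          (m.choose k : ℝ)) := by
  obtain ⟨d, hd⟩ := exists_mulExpect_diagonal_eq x B
  let p : ℝ[X] := ∑ k ∈ range (m + 1), C (d k * m.choose k) * X ^ k
  let q : ℝ[X] := ∑ k ∈ range (m + 1),
    C (x ^ (m - k) * (-1) ^ k * signedCoeff m B.charpoly k) * X ^ k
  have hpq : p = q := by
    -- The expansion of `det (x - s • B)` is available for `s ≠ 0` only; infinitely many values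
    -- suffice.
    refine Polynomial.eq_of_infinite_eval_eq p q
      (((Set.finite_singleton (0 : ℝ)).infinite_compl).mono fun s hs => ?_)
    have h := det_sub_smul_eq_sum x B (show s ≠ 0 from hs)
    rw [← mulExpect_smul_one, hd] at h
    simp only [Set.mem_ofPred_eq, p, q, Polynomial.eval_finsetSum, Polynomial.eval_mul,
      Polynomial.eval_C, Polynomial.eval_pow, Polynomial.eval_X]
    rw [← h]
    refine Finset.sum_congr rfl fun k _ => ?_
    rw [mul_assoc]
    congr 1
    rw [Finset.sum_congr rfl (g := fun _ => s ^ k)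
      (fun S hS => by rw [Finset.prod_const, (Finset.mem_powersetCard.1 hS).2])]
    simp
  rw [hd]
  refine Finset.sum_congr rfl fun k hk => ?_
  have hc := congrArg (fun r : ℝ[X] => r.coeff k) hpq
  simp only [p, q, Polynomial.finsetSum_coeff, Polynomial.coeff_C_mul, Polynomial.coeff_X_pow,
    mul_ite, mul_one, mul_zero, Finset.sum_ite_eq, if_pos hk] at hc
  have hne : (m.choose k : ℝ) ≠ 0 :=
    Nat.cast_ne_zero.2 (Nat.choose_pos (Nat.lt_succ_iff.1 (Finset.mem_range.1 hk))).ne'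
  field_simp
  linear_combination (∑ S ∈ powersetCard k univ, ∏ i ∈ S, a i) * hc

theorem signedCoeff_charpoly_diagonal (a : Fin m → ℝ) {k : ℕ} (hk : k ≤ m) :
    signedCoeff m (Matrix.diagonal a).charpoly k = ∑ S ∈ powersetCard k univ, ∏ i ∈ S, a i := by
  have h := Multiset.prod_X_sub_C_coeff ((univ : Finset (Fin m)).val.map a) (k := m - k) (by simp)
  have h' : (Matrix.diagonal a).charpoly =
      (((univ : Finset (Fin m)).val.map a).map fun t => X - C t).prod := by
    rw [Matrix.charpoly_diagonal, Multiset.map_map]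
    rfl
  have h4 : ((-1 : ℝ) ^ k) * (-1) ^ k = 1 := by rw [← mul_pow]; simp
  rw [signedCoeff, h', h, Multiset.card_map, Finset.card_val, Finset.card_univ, Fintype.card_fin,
    Nat.sub_sub_self hk, Finset.esymm_map_val, ← mul_assoc, h4, one_mul]

/-- The average over orthogonal matrices is given by the coefficient formula. -/
theorem mulExpect_eq_mulConvCoeff {A : Matrix (Fin m) (Fin m) ℝ} (hA : A.IsSymm)
    (B : Matrix (Fin m) (Fin m) ℝ) (x : ℝ) :
    mulExpect A B x = mulConvCoeff m A.charpoly B.charpoly x := by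
  have hH : A.IsHermitian := by simpa [Matrix.IsHermitian, Matrix.IsSymm] using hA
  have hchar : A.charpoly = (Matrix.diagonal hH.eigenvalues).charpoly := by
    rw [hH.charpoly_eq, Matrix.charpoly_diagonal]
    rfl
  obtain ⟨P, hP⟩ := exists_conj (Matrix.isSymm_diagonal hH.eigenvalues) hA hchar
  have h := mulExpect_conj (Matrix.diagonal hH.eigenvalues) B P 1 x
  rw [← hP] at h
  have h1 : (1 : Matrix.orthogonalGroup (Fin m) ℝ).1 * B *
      (1 : Matrix.orthogonalGroup (Fin m) ℝ).1.transpose = B := by simp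
  rw [h1] at h
  rw [h, mulExpect_diagonal_eq, mulConvCoeff, hchar]
  refine Finset.sum_congr rfl fun k hk => ?_
  rw [signedCoeff_charpoly_diagonal _ (Nat.lt_succ_iff.1 (Finset.mem_range.1 hk))]

/-! ### Projections in finite free position -/

/-- A family of determinants which for `t ≠ 0` is, up to a factor, a characteristic polynomial of
`y • A + M`, and which for `t = 0` computes `det (x - A * M)`. -/
noncomputable def pencilDet (A : Matrix (Fin m) (Fin m) ℝ) (x t : ℝ)
    (M : Matrix (Fin m) (Fin m) ℝ) : ℝ :=
  ((1 - A) + x • A - t • ((1 - A) * M) - A * M).det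

/-- The factor does not involve `M`, so it leaves the integral and may vanish without harm. -/
theorem det_sub_mul_eq_pencilDet {A : Matrix (Fin m) (Fin m) ℝ} (hproj : A * A = A) (x : ℝ)
    (M : Matrix (Fin m) (Fin m) ℝ) :
    (x • (1 : Matrix (Fin m) (Fin m) ℝ) - A * M).det =
      (x • (1 - A) + A).det * pencilDet A x 0 M := by
  have h : A * (A * M) = A * M := by rw [← Matrix.mul_assoc, hproj]
  rw [pencilDet, ← Matrix.det_mul]
  congr 1
  simp only [Matrix.mul_sub, Matrix.sub_mul, Matrix.mul_add, Matrix.add_mul, Matrix.mul_smul,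
    Matrix.smul_mul, Matrix.mul_one, Matrix.one_mul, hproj, h, zero_smul, Matrix.mul_zero]
  module

theorem pencilDet_of_ne_zero {A : Matrix (Fin m) (Fin m) ℝ} (hproj : A * A = A) (x : ℝ) {t : ℝ}
    (ht : t ≠ 0) (M : Matrix (Fin m) (Fin m) ℝ) :
    pencilDet A x t M = (t • (1 - A) + A).det *
      (t⁻¹ • (1 : Matrix (Fin m) (Fin m) ℝ) - (t⁻¹ - x) • A - M).det := by
  rw [pencilDet, ← Matrix.det_mul]
  congr 1
  simp only [Matrix.mul_sub, Matrix.sub_mul, Matrix.add_mul, Matrix.mul_smul,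
    Matrix.smul_mul, Matrix.mul_one, Matrix.one_mul, hproj]
  match_scalars <;> field_simp <;> ring

theorem continuous_pencilDet (A : Matrix (Fin m) (Fin m) ℝ) (x : ℝ) :
    Continuous fun z : ℝ × Matrix (Fin m) (Fin m) ℝ => pencilDet A x z.1 z.2 := by
  unfold pencilDet
  refine Continuous.matrix_det ?_
  exact (continuous_const.sub (continuous_fst.smul (continuous_const.matrix_mul continuous_snd))).sub
    (continuous_const.matrix_mul continuous_snd)

theorem pencilDet_eq_integral {A B : Matrix (Fin m) (Fin m) ℝ} (hA : A.IsSymm) (hB : B.IsSymm)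
    (hfree : InFiniteFreePosition A B) (hproj : A * A = A) (x : ℝ) {t : ℝ} (ht : t ≠ 0) :
    pencilDet A x t B =
      ∫ Q : Matrix.orthogonalGroup (Fin m) ℝ,
        pencilDet A x t (Q.1 * B * Q.1.transpose) ∂uniform m := by
  simp_rw [pencilDet_of_ne_zero hproj x ht]
  rw [integral_const_mul]
  congr 1
  -- The spectral variable and `y` both tend to infinity as `t → 0`, with difference fixed at `x`.
  have h := hfree (t⁻¹ - x) 1 t⁻¹
  rw [addConv_charpoly (hA.smul _) (hB.smul _)] at h
  simpa only [one_smul, addExpect] using h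

theorem pencilDet_zero_eq_integral {A B : Matrix (Fin m) (Fin m) ℝ} (hA : A.IsSymm)
    (hB : B.IsSymm) (hfree : InFiniteFreePosition A B) (hproj : A * A = A) (x : ℝ) :
    pencilDet A x 0 B =
      ∫ Q : Matrix.orthogonalGroup (Fin m) ℝ,
        pencilDet A x 0 (Q.1 * B * Q.1.transpose) ∂uniform m := by
  have h1 : Continuous fun t => pencilDet A x t B :=
    (continuous_pencilDet A x).comp (continuous_id.prodMk continuous_const)
  have h2 : Continuous fun t => ∫ Q : Matrix.orthogonalGroup (Fin m) ℝ,
      pencilDet A x t (Q.1 * B * Q.1.transpose) ∂uniform m := by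
    have hc : Continuous (Function.uncurry fun (t : ℝ) (Q : Matrix.orthogonalGroup (Fin m) ℝ) =>
        pencilDet A x t (Q.1 * B * Q.1.transpose)) :=
      (continuous_pencilDet A x).comp
        (continuous_fst.prodMk ((continuous_conj B).comp continuous_snd))
    simpa only [Measure.restrict_univ] using
      continuous_parametric_integral_of_continuous (μ := uniform m) hc isCompact_univ
  have h3 := Continuous.ext_on (dense_compl_singleton (0 : ℝ)) h1 h2
    fun t ht => pencilDet_eq_integral hA hB hfree hproj x ht
  exact congrFun h3 0

theorem det_sub_mul_eq_mulExpect {A B : Matrix (Fin m) (Fin m) ℝ} (hA : A.IsSymm)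
    (hB : B.IsSymm) (hfree : InFiniteFreePosition A B) (hproj : A * A = A) (x : ℝ) :
    (x • (1 : Matrix (Fin m) (Fin m) ℝ) - A * B).det = mulExpect A B x := by
  unfold mulExpect
  simp_rw [det_sub_mul_eq_pencilDet hproj]
  rw [integral_const_mul, pencilDet_zero_eq_integral hA hB hfree hproj x]

end FiniteFree

/-- If real symmetric `A`, `B` are in finite free position and `A² = A`, then
`det(xI - AB) = det(xI - A) ⊠ₘ det(xI - B)`, for the multiplicative convolution given by the
average over orthogonal matrices as well as for the one given by the coefficient formula. -/
theorem mainTheorem11 (m : ℕ) (A B : Matrix (Fin m) (Fin m) ℝ) (hA : A.IsSymm) (hB : B.IsSymm)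
    (hfree : FiniteFree.InFiniteFreePosition A B) (hproj : A * A = A) (x : ℝ) :
    (x • (1 : Matrix (Fin m) (Fin m) ℝ) - A * B).det =
        FiniteFree.mulConv m A.charpoly B.charpoly x ∧
      (x • (1 : Matrix (Fin m) (Fin m) ℝ) - A * B).det =
        FiniteFree.mulConvCoeff m A.charpoly B.charpoly x := by
  have h := FiniteFree.det_sub_mul_eq_mulExpect hA hB hfree hproj x
  exact ⟨h.trans (FiniteFree.mulConv_charpoly hA hB x).symm,
    h.trans (FiniteFree.mulExpect_eq_mulConvCoeff hA B x)⟩
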